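/- **Setting.** Let $T\ge 1$, $\alpha_1,\dots,\alpha_T\in(0,1)$, $\bar\alpha_t=\prod_{j=1}^t\alpha_j$ (so $\bar\alpha_0=1$), $\tau>0$, and $\sigma_t,\tilde\sigma_t>0$ for $1\le t\le T$, with $\sigma_t^2\le 1-\bar\alpha_{t-1}$ for $2\le t\le T$. Let $\mathcal D:\mathbb R^d\to\mathbb R^n$ (decoder), $\mathcal A:\mathbb R^n\to\mathbb R^m$ (corruption operator) and $\epsilon_\theta(\cdot,t):\mathbb R^d\to\mathbb R^d$ be Borel measurable, and fix $y_0,\dots,y_T\in\mathbb R^m$. Write $\mathcal N(x\mid a,vI)$ for the Gaussian density. Put $$\bar z_0(z_t)=\tfrac{1}{\sqrt{\bar\alpha_t}}\bigl(z_t-\sqrt{1-\bar\alpha_t}\,\epsilon_\theta(z_t,t)\bigr),\qquad \mu_\theta(z_t,t)=\sqrt{\bar\alpha_{t-1}}\,\bar z_0(z_t)+\sqrt{1-\bar\alpha_{t-1}-\sigma_t^2}\;\epsilon_\theta(z_t,t)\ (t\ge2),\qquad \mu_\theta(z_1,1)=\bar z_0(z_1).$$ The model is $p_\theta(z_T)=\mathcal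 N(z_T\mid 0,I)$, $p_\theta(z_t\mid z_{t+1})=\mathcal N(z_t\mid\mu_\theta(z_{t+1},t+1),\sigma_{t+1}^2I)$ for $0\le t<T$, and $p_\theta(y_t\mid z_t)=\mathcal N(y_t\mid\mathcal A(\mathcal D(z_t)),\tau^2I)$ for $0\le t\le T$. Its posterior $p_\theta(z_{0:T}\mid y_{0:T})$ is the probability density on $(\mathbb R^d)^{T+1}$ proportional to $p_\theta(z_T)\prod_{t=0}^{T-1}p_\theta(z_t\mid z_{t+1})\prod_{t=0}^Tp_\theta(y_t\mid z_t)$. For $1\le t\le T$ let $\bar p_\theta(y_0\mid z_t)=\mathcal N\bigl(y_0\mid\mathcal A(\mathcal D(\bar z_0(z_t))),(1-\bar\alpha_t)I\bigr)$, and for $0\le t<T$ let $q_\theta(y_t\mid z_{t+1})=\mathcal N\bigl(y_t\mid\mathcal A(\mathcal D(\mu_\theta(z_{t+1},t+1))),\tau^2I\bigr)$. The proposals are $\pi_T=\mathcal N(0,I)$ and, for $0\le t<T$, $\pi_t(\cdot\mid z_{t+1})=\mathcal N(m_t,\tilde\sigma_{t+1}^2I)$ with $$m_t=\mu_\theta(z_{t+1},t+1)-\Bigl(\gamma_t\nabla_{z_{t+1}}\log\bar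 p_\theta(y_0\mid z_{t+1})+\lambda_t\nabla_{\mu_\theta(z_{t+1},t+1)}\log q_\theta(y_t\mid z_{t+1})\Bigr),$$ where the scaling coefficients $\gamma_t,\lambda_t$ are real constants or, more generally, bounded measurable functions of $z_{t+1}$. The unnormalized weights are $$\tilde w_T=p_\theta(y_T\mid z_T)\,\bar p_\theta(y_0\mid z_T),\qquad \tilde w_t=\frac{p_\theta(y_t\mid z_t)\,\bar p_\theta(y_0\mid z_t)\,p_\theta(z_t\mid z_{t+1})}{\bar p_\theta(y_0\mid z_{t+1})\,\pi_t(z_t\mid z_{t+1})}\ (0<t<T),\qquad \tilde w_0=\frac{p_\theta(y_0\mid z_0)\,p_\theta(z_0\mid z_1)}{\bar p_\theta(y_0\mid z_1)\,\pi_0(z_0\mid z_1)}.$$ The SISR procedure with $N$ particles draws $z_T^{(1)},\dots,z_T^{(N)}$ independently from $\pi_T$. Then, for $t=T-1,\dots,0$, it replaces the $N$ current paths by $N$ independent draws from them with probabilities proportional to their current weights $\tilde w_{t+1}$ (multinomial resampling), and extends each resampled path $(z_{t+1},\dots,z_T)$, independently, by $z_t\sim\pi_t(\cdot\mid z_{t+1})$.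 Let $z_{0:T}^{(i)}$ be the final paths, $w_0^{(i)}$ their weights $\tilde w_0$ normalized to sum to one, and $\mathbb P_N=\sum_{i=1}^Nw_0^{(i)}\delta_{z_{0:T}^{(i)}}$. The runs for all $N$ are defined on one probability space, with an arbitrary joint law across different $N$. **Proposition.** Assume: (a) the functions $p_\theta(y_t\mid z_t)$ ($0\le t\le T$), the ratios $\bar p_\theta(y_0\mid z_t)/\bar p_\theta(y_0\mid z_{t+1})$ ($1\le t<T$), the ratio $p_\theta(y_0\mid z_0)/\bar p_\theta(y_0\mid z_1)$ and $\bar p_\theta(y_0\mid z_T)$ are positive and bounded, as functions of all the latent variables that occur in them; (b) for $1\le t\le T$, $\log\bar p_\theta(y_0\mid z_t)$ is continuous and differentiable with bounded gradient, as a function of $z_t\in\mathbb R^d$; (c) for $0\le t<T$, $\log\mathcal N(y_t\mid\mathcal A(\mathcal D(u)),\tau^2I)$, which is $\log q_\theta(y_t\mid z_{t+1})$ at $u=\mu_\theta(z_{t+1},t+1)$, is continuous and differentiable with bounded gradient, as a function of $u\in\mathbb R^d$; (d) $\tilde\sigma_t^2>\sigma_t^2$ for $1\le t\le T$. Then the posterior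 is a well-defined probability measure and, for every set $E\subseteq(\mathbb R^d)^{T+1}$ that is measurable with respect to (the completion of) the posterior, with probability one, $$\lim_{N\to\infty}\mathbb P_N(E)=\int_Ep_\theta(z_{0:T}\mid y_{0:T})\,dz_{0:T}.$$ -/

import Mathlib

open MeasureTheory ProbabilityTheory Filter
open scoped ENNReal Topology Gradient

/-- The density of the isotropic Gaussian `𝒩(m, v I)` on `ℝ^k`, evaluated at `x` (`v` is the
variance). -/
noncomputable def gaussianDensity {k : ℕ} (m : EuclideanSpace ℝ (Fin k)) (v : ℝ)
    (x : EuclideanSpace ℝ (Fin k)) : ℝ :=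
  (√(2 * Real.pi * v))⁻¹ ^ k * Real.exp (-‖x - m‖ ^ 2 / (2 * v))

/-- The Gaussian law `𝒩(m, v I)` on `ℝ^k`. -/
noncomputable def gaussianMeasure {k : ℕ} (m : EuclideanSpace ℝ (Fin k)) (v : ℝ) :
    Measure (EuclideanSpace ℝ (Fin k)) :=
  volume.withDensity fun x => ENNReal.ofReal (gaussianDensity m v x)

/-- A function is positive everywhere and bounded. -/
def PosBounded {S : Type*} (f : S → ℝ) : Prop :=
  (∀ s, 0 < f s) ∧ ∃ C : ℝ, ∀ s, f s ≤ C

/-- A real function on `ℝ^k` is continuous and has a gradient everywhere, which is bounded. -/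
def HasBoundedGradient {k : ℕ} (f : EuclideanSpace ℝ (Fin k) → ℝ) : Prop :=
  Continuous f ∧ Differentiable ℝ f ∧ ∃ C : ℝ, ∀ x, ‖∇ f x‖ ≤ C

/-- The data of the latent diffusion inverse problem and of its sampler. The latent space is
`ℝ^d`, the image space `ℝ^n`, the observation space `ℝ^m`. Functions of the time index are indexed
by `ℕ`; only the values at times `0, …, T` matter. -/
structure LDSMC (d n m : ℕ) where
  /-- number of diffusion steps -/
  T : ℕ
  one_le_T : 1 ≤ T
  /-- variance schedule -/
  α : ℕ → ℝ
  α_pos : ∀ t, 1 ≤ t → t ≤ T → 0 < α t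
  α_lt_one : ∀ t, 1 ≤ t → t ≤ T → α t < 1
  /-- standard deviations of the prior (reverse diffusion) transitions -/
  σ : ℕ → ℝ
  σ_pos : ∀ t, 1 ≤ t → t ≤ T → 0 < σ t
  /-- the square root in the mean of the reverse transition is that of a non-negative number -/
  σ_sq_le : ∀ t, 2 ≤ t → t ≤ T → σ t ^ 2 ≤ 1 - ∏ j ∈ Finset.Icc 1 (t - 1), α j
  /-- standard deviation of the observation noise -/
  τ : ℝ
  τ_pos : 0 < τ
  /-- the noise prediction network `ε_θ(z, t)` -/
  ε : ℕ → EuclideanSpace ℝ (Fin d) → EuclideanSpace ℝ (Fin d)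
  measurable_ε : ∀ t, Measurable (ε t)
  /-- decoder -/
  D : EuclideanSpace ℝ (Fin d) → EuclideanSpace ℝ (Fin n)
  measurable_D : Measurable D
  /-- corruption operator -/
  A : EuclideanSpace ℝ (Fin n) → EuclideanSpace ℝ (Fin m)
  measurable_A : Measurable A
  /-- the observation `y 0` and the auxiliary observations `y 1, …, y T` -/
  y : ℕ → EuclideanSpace ℝ (Fin m)
  /-- standard deviations of the proposals -/
  σ' : ℕ → ℝ
  σ'_pos : ∀ t, 1 ≤ t → t ≤ T → 0 < σ' t
  /-- scaling coefficients of the proposal means; they may be constants, or may be computed from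
  the current latent as long as they stay bounded -/
  γ : ℕ → EuclideanSpace ℝ (Fin d) → ℝ
  measurable_γ : ∀ t, Measurable (γ t)
  bounded_γ : ∀ t, t < T → ∃ C : ℝ, ∀ z, |γ t z| ≤ C
  lam : ℕ → EuclideanSpace ℝ (Fin d) → ℝ
  measurable_lam : ∀ t, Measurable (lam t)
  bounded_lam : ∀ t, t < T → ∃ C : ℝ, ∀ z, |lam t z| ≤ C

namespace LDSMC

variable {d n m : ℕ}

section Model

/-- `ᾱ_t = ∏_{j=1}^t α_j`. -/
noncomputable def abar (M : LDSMC d n m) (t : ℕ) : ℝ := ∏ j ∈ Finset.Icc 1 t, M.α j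

/-- The approximate posterior mean `z̄₀(z_t)`. -/
noncomputable def z0bar (M : LDSMC d n m) (t : ℕ) (z : EuclideanSpace ℝ (Fin d)) :
    EuclideanSpace ℝ (Fin d) :=
  (1 / √(M.abar t)) • (z - √(1 - M.abar t) • M.ε t z)

/-- The mean `μ_θ(z, t)` of the reverse transition from time `t` to time `t - 1` (DDIM). -/
noncomputable def μ (M : LDSMC d n m) (t : ℕ) (z : EuclideanSpace ℝ (Fin d)) :
    EuclideanSpace ℝ (Fin d) :=
  if t = 1 then M.z0bar 1 z
  else √(M.abar (t - 1)) • M.z0bar t z + √(1 - M.abar (t - 1) - M.σ t ^ 2) • M.ε t z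

/-- The prior transition density `p_θ(z_t | z_{t+1})`, as a function of `z_{t+1}` and `z_t`. -/
noncomputable def trans (M : LDSMC d n m) (t : ℕ) (z' z : EuclideanSpace ℝ (Fin d)) : ℝ :=
  gaussianDensity (M.μ (t + 1) z') (M.σ (t + 1) ^ 2) z

/-- The likelihood `p_θ(y_t | z_t) = 𝒩(y_t | A(D(z_t)), τ² I)`. -/
noncomputable def lik (M : LDSMC d n m) (t : ℕ) (z : EuclideanSpace ℝ (Fin d)) : ℝ :=
  gaussianDensity (M.A (M.D z)) (M.τ ^ 2) (M.y t)

/-- `p̄_θ(y_0 | z_t) = 𝒩(y_0 | A(D(z̄₀(z_t))), (1 - ᾱ_t) I)`, for `1 ≤ t ≤ T`. -/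
noncomputable def pbar (M : LDSMC d n m) (t : ℕ) (z : EuclideanSpace ℝ (Fin d)) : ℝ :=
  gaussianDensity (M.A (M.D (M.z0bar t z))) (1 - M.abar t) (M.y 0)

/-- `p_θ(z_{0:T}) p_θ(y_{0:T} | z_{0:T})`, at the given observations `y_{0:T}`, as a function of
`z_{0:T}`. -/
noncomputable def jointDensity (M : LDSMC d n m)
    (z : Fin (M.T + 1) → EuclideanSpace ℝ (Fin d)) : ℝ :=
  gaussianDensity 0 1 (z (Fin.last M.T)) *
    (∏ t : Fin M.T, M.trans t (z t.succ) (z t.castSucc)) *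
    ∏ t : Fin (M.T + 1), M.lik t (z t)

/-- The evidence `p_θ(y_{0:T})`. -/
noncomputable def evidence (M : LDSMC d n m) : ℝ≥0∞ :=
  ∫⁻ z : Fin (M.T + 1) → EuclideanSpace ℝ (Fin d), ENNReal.ofReal (M.jointDensity z)

/-- The posterior `p_θ(z_{0:T} | y_{0:T}) dz_{0:T}`, given by Bayes' formula. -/
noncomputable def posterior (M : LDSMC d n m) :
    Measure (Fin (M.T + 1) → EuclideanSpace ℝ (Fin d)) :=
  volume.withDensity fun z => ENNReal.ofReal (M.jointDensity z) / M.evidence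

end Model

section Sampler

/-- `log p̄_θ(y_0 | z_t)`, as a function of `z_t`. -/
noncomputable def logPbar (M : LDSMC d n m) (t : ℕ) (z : EuclideanSpace ℝ (Fin d)) : ℝ :=
  Real.log (M.pbar t z)

/-- `log q_θ(y_t | z_{t+1}) = log 𝒩(y_t | A(D(u)), τ² I)`, as a function of
`u = μ_θ(z_{t+1}, t+1)`. -/
noncomputable def logQ (M : LDSMC d n m) (t : ℕ) (u : EuclideanSpace ℝ (Fin d)) : ℝ :=
  Real.log (gaussianDensity (M.A (M.D u)) (M.τ ^ 2) (M.y t))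

/-- The mean `m_t` of the proposal at time `t`, as a function of `z_{t+1}`. -/
noncomputable def propMean (M : LDSMC d n m) (t : ℕ) (z : EuclideanSpace ℝ (Fin d)) :
    EuclideanSpace ℝ (Fin d) :=
  M.μ (t + 1) z -
    (M.γ t z • ∇ (M.logPbar (t + 1)) z + M.lam t z • ∇ (M.logQ t) (M.μ (t + 1) z))

/-- The proposal density `π_t(z_t | z_{t+1})`, as a function of `z_{t+1}` and `z_t`. -/
noncomputable def propDensity (M : LDSMC d n m) (t : ℕ) (z' z : EuclideanSpace ℝ (Fin d)) : ℝ :=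
  gaussianDensity (M.propMean t z') (M.σ' (t + 1) ^ 2) z

/-- The proposal law `π_t(· | z_{t+1})`. -/
noncomputable def propMeasure (M : LDSMC d n m) (t : ℕ) (z' : EuclideanSpace ℝ (Fin d)) :
    Measure (EuclideanSpace ℝ (Fin d)) :=
  gaussianMeasure (M.propMean t z') (M.σ' (t + 1) ^ 2)

/-- The unnormalized weight at time `T`; there the proposal is the prior. -/
noncomputable def weightT (M : LDSMC d n m) (z : EuclideanSpace ℝ (Fin d)) : ℝ :=
  M.lik M.T z * M.pbar M.T z

/-- The unnormalized weight at time `t < T`, as a function of `z_t` and `z_{t+1}`. -/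
noncomputable def weight (M : LDSMC d n m) (t : ℕ) (z z' : EuclideanSpace ℝ (Fin d)) : ℝ :=
  if t = 0 then M.lik 0 z * M.trans 0 z' z / (M.pbar 1 z' * M.propDensity 0 z' z)
  else M.lik t z * M.pbar t z * M.trans t z' z / (M.pbar (t + 1) z' * M.propDensity t z' z)

/-- The unnormalized weight of a particle after `s` steps, i.e. at time `t = T - s`. Such a particle
is a path `z_{t:T} = (z_t, z_{t+1}, …, z_T)`, stored with entry `k` equal to `z_{t+k}`. -/
noncomputable def pathWeight (M : LDSMC d n m) :
    (s : ℕ) → (Fin (s + 1) → EuclideanSpace ℝ (Fin d)) → ℝ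
  | 0, z => M.weightT (z 0)
  | s + 1, z => M.weight (M.T - (s + 1)) (z 0) (z 1)

/-- The normalized weight of particle `i` after `s` steps. -/
noncomputable def normWeight (M : LDSMC d n m) (s : ℕ) {N : ℕ}
    (x : Fin N → Fin (s + 1) → EuclideanSpace ℝ (Fin d)) (i : Fin N) : ℝ :=
  M.pathWeight s (x i) / ∑ j, M.pathWeight s (x j)

/-- The weighted particle measure `∑ i, w^(i) δ_{z^(i)}` after `s` steps. -/
noncomputable def particleMeasure (M : LDSMC d n m) (s : ℕ) {N : ℕ}
    (x : Fin N → Fin (s + 1) → EuclideanSpace ℝ (Fin d)) :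
    Measure (Fin (s + 1) → EuclideanSpace ℝ (Fin d)) :=
  ∑ i, ENNReal.ofReal (M.normWeight s x i) • Measure.dirac (x i)

/-- Multinomial resampling: given the particles `x`, the law of `N` independent draws from
their weighted particle measure. -/
noncomputable def resample (M : LDSMC d n m) (s : ℕ) {N : ℕ}
    (x : Fin N → Fin (s + 1) → EuclideanSpace ℝ (Fin d)) :
    Measure (Fin N → Fin (s + 1) → EuclideanSpace ℝ (Fin d)) :=
  Measure.pi fun _ : Fin N => M.particleMeasure s x

/-- The law of the extended path `(z_t, z_{t+1}, …, z_T)` with `z_t ∼ π_t(· | z_{t+1})`, given the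
path `p = (z_{t+1}, …, z_T)`. -/
noncomputable def extend (M : LDSMC d n m) (t s : ℕ)
    (p : Fin (s + 1) → EuclideanSpace ℝ (Fin d)) :
    Measure (Fin (s + 2) → EuclideanSpace ℝ (Fin d)) :=
  (M.propMeasure t (p 0)).map fun z => (Fin.cons z p : Fin (s + 2) → EuclideanSpace ℝ (Fin d))

/-- Propagation: given the particles `x`, each is extended independently of the others. -/
noncomputable def propagate (M : LDSMC d n m) (t s : ℕ) {N : ℕ}
    (x : Fin N → Fin (s + 1) → EuclideanSpace ℝ (Fin d)) :
    Measure (Fin N → Fin (s + 2) → EuclideanSpace ℝ (Fin d)) :=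
  Measure.pi fun i : Fin N => M.extend t s (x i)

/-- The law of the `N` particles of the SISR procedure after `s` steps, i.e. at time `T - s`:
independent draws from `π_T = 𝒩(0, I)`, followed at every step by multinomial resampling according
to the current normalized weights and by propagation with the proposal. -/
noncomputable def sisrLaw (M : LDSMC d n m) (N : ℕ) :
    (s : ℕ) → Measure (Fin N → Fin (s + 1) → EuclideanSpace ℝ (Fin d))
  | 0 => Measure.pi fun _ : Fin N =>
      (gaussianMeasure 0 1).map fun z => (fun _ => z : Fin 1 → EuclideanSpace ℝ (Fin d))
  | s + 1 => ((M.sisrLaw N s).bind (M.resample s)).bind (M.propagate (M.T - (s + 1)) s)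

end Sampler

end LDSMC

namespace LDSMC

section WellDefined

variable {d n m : ℕ}

theorem measurable_gaussianDensity {S : Type*} [MeasurableSpace S] {k : ℕ}
    {f g : S → EuclideanSpace ℝ (Fin k)} (hf : Measurable f) (hg : Measurable g) (v : ℝ) :
    Measurable fun s => gaussianDensity (f s) v (g s) := by
  unfold gaussianDensity
  fun_prop

theorem gaussianDensity_pos {k : ℕ} (a x : EuclideanSpace ℝ (Fin k)) {v : ℝ} (hv : 0 < v) :
    0 < gaussianDensity a v x := by
  unfold gaussianDensity
  positivity

theorem isProbabilityMeasure_gaussianMeasure {k : ℕ} (a : EuclideanSpace ℝ (Fin k)) {v : ℝ}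
    (hv : 0 < v) : IsProbabilityMeasure (gaussianMeasure a v) := by
  constructor
  have hb : 0 < (2 * v)⁻¹ := by positivity
  have h1 : ∫ x : EuclideanSpace ℝ (Fin k), Real.exp (-(2 * v)⁻¹ * ‖x - a‖ ^ 2)
      = (Real.pi / (2 * v)⁻¹) ^ ((k : ℝ) / 2) := by
    rw [integral_sub_right_eq_self
      (fun x : EuclideanSpace ℝ (Fin k) => Real.exp (-(2 * v)⁻¹ * ‖x‖ ^ 2)) a,
      GaussianFourier.integral_rexp_neg_mul_sq_norm hb]
    simp
  have h2 : ∫ x, gaussianDensity a v x = 1 := by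
    have : ∀ x, gaussianDensity a v x =
        (√(2 * Real.pi * v))⁻¹ ^ k * Real.exp (-(2 * v)⁻¹ * ‖x - a‖ ^ 2) := by
      intro x
      unfold gaussianDensity
      congr 2
      field_simp
    simp_rw [this]
    rw [integral_const_mul, h1]
    have h3 : Real.pi / (2 * v)⁻¹ = 2 * Real.pi * v := by field_simp
    have h4 : 0 < 2 * Real.pi * v := by positivity
    rw [h3, Real.sqrt_eq_rpow, ← Real.rpow_neg h4.le, ← Real.rpow_natCast, ← Real.rpow_mul h4.le,
      ← Real.rpow_add h4]
    rw [show -(1 / 2 : ℝ) * (k : ℝ) + (k : ℝ) / 2 = 0 by ring, Real.rpow_zero]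
  have h5 : Integrable (fun x => gaussianDensity a v x) := by
    by_contra h
    rw [integral_undef h] at h2
    exact zero_ne_one h2
  rw [gaussianMeasure, withDensity_apply _ MeasurableSet.univ, Measure.restrict_univ,
    ← ofReal_integral_eq_lintegral_ofReal h5
      (Eventually.of_forall fun x => (gaussianDensity_pos a x hv).le), h2, ENNReal.ofReal_one]

theorem measurable_measure_pi {ι S R : Type*} [Fintype ι] [MeasurableSpace S] [MeasurableSpace R]
    {κ : ι → S → Measure R} (hκ : ∀ i, Measurable (κ i)) [∀ i s, IsFiniteMeasure (κ i s)] :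
    Measurable fun s => Measure.pi fun i => κ i s := by
  refine Measurable.measure_of_isPiSystem (generateFrom_pi (α := fun _ : ι => R)).symm
    isPiSystem_pi ?_ ?_
  · rintro _ ⟨B, hB, rfl⟩
    simp only [Measure.pi_pi]
    exact Finset.measurable_prod _ fun i _ =>
      (Measure.measurable_coe (hB i (Set.mem_univ i))).comp (hκ i)
  · simp only [Measure.pi_univ]
    exact Finset.measurable_prod _ fun i _ =>
      (Measure.measurable_coe MeasurableSet.univ).comp (hκ i)

variable (M : LDSMC d n m)

theorem abar_lt_one {t : ℕ} (h1 : 1 ≤ t) (hT : t ≤ M.T) : M.abar t < 1 := by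
  unfold abar
  have h : ∀ j ∈ Finset.Icc 1 t, 0 < M.α j ∧ M.α j < 1 := fun j hj => by
    rw [Finset.mem_Icc] at hj
    exact ⟨M.α_pos j hj.1 (hj.2.trans hT), M.α_lt_one j hj.1 (hj.2.trans hT)⟩
  calc ∏ j ∈ Finset.Icc 1 t, M.α j < ∏ _j ∈ Finset.Icc 1 t, (1 : ℝ) :=
        Finset.prod_lt_prod_of_nonempty (fun j hj => (h j hj).1) (fun j hj => (h j hj).2)
          ⟨1, by simp [h1]⟩
    _ = 1 := by simp

theorem measurable_z0bar (t : ℕ) : Measurable (M.z0bar t) := by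
  have := M.measurable_ε t
  unfold z0bar
  fun_prop

theorem measurable_μ (t : ℕ) : Measurable (M.μ t) := by
  have h1 := M.measurable_ε t
  have h2 := M.measurable_z0bar t
  have h3 := M.measurable_z0bar 1
  unfold μ
  split_ifs <;> fun_prop

theorem measurable_lik (t : ℕ) : Measurable (M.lik t) :=
  measurable_gaussianDensity (M.measurable_A.comp M.measurable_D) measurable_const _

theorem measurable_pbar (t : ℕ) : Measurable (M.pbar t) :=
  measurable_gaussianDensity (M.measurable_A.comp (M.measurable_D.comp (M.measurable_z0bar t)))
    measurable_const _

theorem measurable_gradient (f : EuclideanSpace ℝ (Fin d) → ℝ) : Measurable (∇ f) :=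
  (InnerProductSpace.toDual ℝ (EuclideanSpace ℝ (Fin d))).symm.continuous.measurable.comp
    (measurable_fderiv ℝ f)

theorem measurable_propMean (t : ℕ) : Measurable (M.propMean t) := by
  have h1 := M.measurable_μ (t + 1)
  have h2 := M.measurable_γ t
  have h3 := M.measurable_lam t
  have h4 := measurable_gradient (M.logPbar (t + 1))
  have h5 := (measurable_gradient (M.logQ t)).comp h1
  exact h1.sub ((h2.smul h4).add (h3.smul h5))

theorem measurable_pathWeight (s : ℕ) : Measurable (M.pathWeight s) := by
  cases s with
  | zero =>
    exact ((M.measurable_lik _).mul (M.measurable_pbar _)).comp (measurable_pi_apply 0)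
  | succ s =>
    have e : ∀ i, Measurable fun z : Fin (s + 1 + 1) → EuclideanSpace ℝ (Fin d) => z i :=
      fun i => measurable_pi_apply i
    have hl := fun t => (M.measurable_lik t).comp (e 0)
    have hp := fun t => (M.measurable_pbar t).comp (e 0)
    have hp' := fun t => (M.measurable_pbar t).comp (e 1)
    have ht := fun t => measurable_gaussianDensity ((M.measurable_μ (t + 1)).comp (e 1)) (e 0)
      (M.σ (t + 1) ^ 2)
    have hq := fun t => measurable_gaussianDensity ((M.measurable_propMean t).comp (e 1)) (e 0)
      (M.σ' (t + 1) ^ 2)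
    change Measurable fun z : Fin (s + 1 + 1) → EuclideanSpace ℝ (Fin d) =>
      M.weight (M.T - (s + 1)) (z 0) (z 1)
    unfold weight
    split_ifs
    · exact ((hl 0).mul (ht 0)).div ((hp' 1).mul (hq 0))
    · exact (((hl _).mul (hp _)).mul (ht _)).div ((hp' _).mul (hq _))

theorem pathWeight_pos {s : ℕ} (hs : s ≤ M.T) (z : Fin (s + 1) → EuclideanSpace ℝ (Fin d)) :
    0 < M.pathWeight s z := by
  have hT := M.one_le_T
  have hl : ∀ t u, 0 < M.lik t u := fun t u => gaussianDensity_pos _ _ (pow_pos M.τ_pos 2)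
  have hp : ∀ t, 1 ≤ t → t ≤ M.T → ∀ u, 0 < M.pbar t u := fun t h1 h2 u =>
    gaussianDensity_pos _ _ (sub_pos.2 (M.abar_lt_one h1 h2))
  have ht : ∀ t, t + 1 ≤ M.T → ∀ u v, 0 < M.trans t u v := fun t h u v =>
    gaussianDensity_pos _ _ (pow_pos (M.σ_pos _ (by omega) h) 2)
  have hq : ∀ t, t + 1 ≤ M.T → ∀ u v, 0 < M.propDensity t u v := fun t h u v =>
    gaussianDensity_pos _ _ (pow_pos (M.σ'_pos _ (by omega) h) 2)
  cases s with
  | zero => exact mul_pos (hl _ _) (hp _ hT le_rfl _)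
  | succ s =>
    change 0 < M.weight (M.T - (s + 1)) (z 0) (z 1)
    unfold weight
    split_ifs with h
    · exact div_pos (mul_pos (hl _ _) (ht _ hT _ _)) (mul_pos (hp _ le_rfl hT _) (hq _ hT _ _))
    · exact div_pos (mul_pos (mul_pos (hl _ _) (hp _ (by omega) (by omega) _))
        (ht _ (by omega) _ _)) (mul_pos (hp _ (by omega) (by omega) _) (hq _ (by omega) _ _))

theorem isProbabilityMeasure_particleMeasure {s N : ℕ} (hs : s ≤ M.T) (hN : 0 < N)
    (x : Fin N → Fin (s + 1) → EuclideanSpace ℝ (Fin d)) :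
    IsProbabilityMeasure (M.particleMeasure s x) := by
  have : NeZero N := ⟨hN.ne'⟩
  have hpos : 0 < ∑ j, M.pathWeight s (x j) :=
    Finset.sum_pos (fun j _ => M.pathWeight_pos hs (x j)) Finset.univ_nonempty
  constructor
  simp only [particleMeasure, Measure.coe_finsetSum, Finset.sum_apply, Measure.smul_apply,
    measure_univ, smul_eq_mul, mul_one]
  simp only [normWeight]
  rw [← ENNReal.ofReal_sum_of_nonneg fun i _ =>
    div_nonneg (M.pathWeight_pos hs (x i)).le hpos.le]
  rw [← Finset.sum_div, div_self hpos.ne', ENNReal.ofReal_one]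

instance isFiniteMeasure_particleMeasure {s N : ℕ}
    (x : Fin N → Fin (s + 1) → EuclideanSpace ℝ (Fin d)) :
    IsFiniteMeasure (M.particleMeasure s x) := by
  constructor
  simp only [particleMeasure, Measure.coe_finsetSum, Finset.sum_apply, Measure.smul_apply,
    measure_univ, smul_eq_mul, mul_one]
  exact ENNReal.sum_lt_top.2 fun i _ => ENNReal.ofReal_lt_top

theorem measurable_particleMeasure (s N : ℕ) :
    Measurable (M.particleMeasure s (N := N)) := by
  have hw := M.measurable_pathWeight s
  have e : ∀ i : Fin N, Measurable
      fun x : Fin N → Fin (s + 1) → EuclideanSpace ℝ (Fin d) => x i := measurable_pi_apply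
  refine Measure.measurable_of_measurable_coe _ fun B hB => ?_
  simp only [particleMeasure, Measure.coe_finsetSum, Finset.sum_apply, Measure.smul_apply,
    smul_eq_mul]
  refine Finset.measurable_sum _ fun i _ => Measurable.mul ?_ ?_
  · exact ((hw.comp (e i)).div (Finset.measurable_sum _ fun j _ => hw.comp (e j))).ennreal_ofReal
  · exact (Measure.measurable_coe hB).comp (Measure.measurable_dirac.comp (e i))

theorem measurable_resample (s N : ℕ) : Measurable (M.resample s (N := N)) :=
  measurable_measure_pi fun _ => M.measurable_particleMeasure s N

theorem isProbabilityMeasure_propMeasure {t : ℕ} (ht : t < M.T) (z : EuclideanSpace ℝ (Fin d)) :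
    IsProbabilityMeasure (M.propMeasure t z) :=
  isProbabilityMeasure_gaussianMeasure _ (pow_pos (M.σ'_pos _ (by omega) ht) 2)

theorem measurable_cons (s : ℕ) :
    Measurable fun q : (Fin (s + 1) → EuclideanSpace ℝ (Fin d)) × EuclideanSpace ℝ (Fin d) =>
      (Fin.cons q.2 q.1 : Fin (s + 2) → EuclideanSpace ℝ (Fin d)) := by
  refine measurable_pi_lambda _ fun i => ?_
  refine Fin.cases ?_ (fun j => ?_) i
  · simpa using measurable_snd
  · simp only [Fin.cons_succ]
    exact (measurable_pi_apply j).comp measurable_fst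

theorem isProbabilityMeasure_extend {t : ℕ} (ht : t < M.T) (s : ℕ)
    (p : Fin (s + 1) → EuclideanSpace ℝ (Fin d)) : IsProbabilityMeasure (M.extend t s p) :=
  have := M.isProbabilityMeasure_propMeasure ht (p 0)
  Measure.isProbabilityMeasure_map
    ((measurable_cons s).comp (measurable_const.prodMk measurable_id)).aemeasurable

theorem measurable_extend (t s : ℕ) : Measurable (M.extend t s) := by
  refine Measure.measurable_of_measurable_coe _ fun B hB => ?_
  have hc : ∀ p : Fin (s + 1) → EuclideanSpace ℝ (Fin d), Measurable fun z =>
      (Fin.cons z p : Fin (s + 2) → EuclideanSpace ℝ (Fin d)) := fun p =>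
    (measurable_cons s).comp (measurable_const.prodMk measurable_id)
  have h : ∀ p : Fin (s + 1) → EuclideanSpace ℝ (Fin d), M.extend t s p B =
      ∫⁻ z, ((fun q : (Fin (s + 1) → EuclideanSpace ℝ (Fin d)) × EuclideanSpace ℝ (Fin d) =>
        (Fin.cons q.2 q.1 : Fin (s + 2) → EuclideanSpace ℝ (Fin d))) ⁻¹' B).indicator
        (fun q => ENNReal.ofReal (M.propDensity t (q.1 0) q.2)) (p, z) := by
    intro p
    rw [extend, Measure.map_apply (hc p) hB, propMeasure, gaussianMeasure,
      withDensity_apply _ (hc p hB), ← lintegral_indicator (hc p hB)]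
    rfl
  simp_rw [h]
  refine Measurable.lintegral_prod_right' (Measurable.indicator ?_ (measurable_cons s hB))
  exact (measurable_gaussianDensity ((M.measurable_propMean t).comp
    ((measurable_pi_apply 0).comp measurable_fst)) measurable_snd _).ennreal_ofReal

theorem measurable_propagate {t : ℕ} (ht : t < M.T) (s N : ℕ) :
    Measurable (M.propagate t s (N := N)) :=
  have := fun p => M.isProbabilityMeasure_extend ht s p
  measurable_measure_pi fun i => (M.measurable_extend t s).comp (measurable_pi_apply i)

/-- The law of the particles is a probability measure; in particular none of the operations in its
definition takes a default value. -/
theorem isProbabilityMeasure_sisrLaw (N : ℕ) :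
    ∀ s, s ≤ M.T → IsProbabilityMeasure (M.sisrLaw N s)
  | 0, _ => by
    have := isProbabilityMeasure_gaussianMeasure (0 : EuclideanSpace ℝ (Fin d)) one_pos
    have : IsProbabilityMeasure ((gaussianMeasure (0 : EuclideanSpace ℝ (Fin d)) 1).map
        fun z => (fun _ => z : Fin 1 → EuclideanSpace ℝ (Fin d))) :=
      Measure.isProbabilityMeasure_map
        (measurable_pi_lambda _ fun _ => measurable_id).aemeasurable
    change IsProbabilityMeasure (Measure.pi _)
    infer_instance
  | s + 1, hs => by
    have := isProbabilityMeasure_sisrLaw N s (by omega)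
    have ht : M.T - (s + 1) < M.T := by omega
    have h1 : ∀ x, IsProbabilityMeasure (M.resample s (N := N) x) := by
      intro x
      rcases Nat.eq_zero_or_pos N with rfl | hN
      · constructor
        simp [resample]
      · have := M.isProbabilityMeasure_particleMeasure (by omega : s ≤ M.T) hN x
        unfold resample
        infer_instance
    have h2 : ∀ x, IsProbabilityMeasure (M.propagate (M.T - (s + 1)) s (N := N) x) := by
      intro x
      have := fun p => M.isProbabilityMeasure_extend ht s p
      unfold propagate
      infer_instance
    have : IsProbabilityMeasure ((M.sisrLaw N s).bind (M.resample s)) :=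
      isProbabilityMeasure_bind (M.measurable_resample s N).aemeasurable
        (Eventually.of_forall h1)
    exact isProbabilityMeasure_bind (M.measurable_propagate ht s N).aemeasurable
      (Eventually.of_forall h2)

end WellDefined

end LDSMC

/-! The sampler is an interacting particle approximation of a Feynman–Kac flow. `filterMeasure s`
has an explicit density on paths. Multiplying it by the proposal and then by the next weight
produces the density one step longer, because the proposal densities and the intermediate factors
`pbar` cancel (`pathDensity_cons`, `predMeasure_withDensity`). At `s = T` only the joint density is
left, so its normalization is the posterior.

The weights are bounded. The gradient bounds keep the proposal mean within a fixed distance of the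
prior mean, and a Gaussian divided by a wider Gaussian with a boundedly shifted mean is bounded
(`gaussianDensity_div_le`); (a) bounds the other factors.

For bounded test functions, resampling and propagation are conditionally independent draws, so
Hoeffding's inequality controls their error by a geometric sequence in `N` that does not depend on
the current particles (`pi_deviation_le`). Weighting is a ratio of two empirical means whose
denominator has a positive limit. Hence summability of deviation probabilities passes from each step
to the next. This mode of convergence involves only the law for each `N` separately, so
Borel–Cantelli gives almost sure convergence whatever the joint law across `N`. -/

/-! ### Complete convergence. -/

/-- The random variables `g N`, under the laws `ρ N`, converge completely to `c`: the probabilities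
of deviations by any fixed amount are summable. -/
def CompletelyTendsto {A : ℕ → Type*} [∀ N, MeasurableSpace (A N)] (ρ : ∀ N, Measure (A N))
    (g : ∀ N, A N → ℝ) (c : ℝ) : Prop :=
  ∀ ε : ℝ, 0 < ε → ∑' N, ρ N {x | ε ≤ |g N x - c|} ≠ ∞

namespace CompletelyTendsto

variable {A : ℕ → Type*} [∀ N, MeasurableSpace (A N)] {ρ : ∀ N, Measure (A N)}
  {g h : ∀ N, A N → ℝ} {a b c : ℝ}

/-- The first Borel–Cantelli lemma needs no independence, so a coupling of the laws `ρ N` plays no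
role. It is applied to the countably many thresholds `1 / (k + 1)`. -/
theorem ae_tendsto (hg : CompletelyTendsto ρ g c) {Ω : Type*} [MeasurableSpace Ω] {P : Measure Ω}
    {X : ∀ N, Ω → A N} (hX : ∀ N, HasLaw (X N) (ρ N) P) :
    ∀ᵐ ω ∂P, Tendsto (fun N => g N (X N ω)) atTop (𝓝 c) := by
  have key : ∀ k : ℕ, ∀ᵐ ω ∂P, ∀ᶠ N in atTop, ω ∉ {ω | 1 / ((k : ℝ) + 1) ≤ |g N (X N ω) - c|} := by
    intro k
    refine ae_eventually_notMem (ne_top_of_le_ne_top (hg (1 / ((k : ℝ) + 1)) Nat.one_div_pos_of_nat)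
      (ENNReal.tsum_le_tsum fun N => ?_))
    rw [← (hX N).map_eq]
    -- Only an inequality: `g N` is not assumed measurable, so neither is the deviation set.
    exact Measure.le_map_apply (hX N).aemeasurable _
  filter_upwards [ae_all_iff.2 key] with ω hω
  rw [Metric.tendsto_atTop']
  intro ε hε
  obtain ⟨k, hk⟩ := exists_nat_one_div_lt hε
  obtain ⟨n, hn⟩ := eventually_atTop.1 (hω k)
  refine ⟨n, fun N hN => ?_⟩
  have := hn N hN.le
  simp only [not_le] at this
  exact this.trans hk

theorem continuousAt_comp₂ (hg : CompletelyTendsto ρ g a) (hh : CompletelyTendsto ρ h b)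
    {F : ℝ × ℝ → ℝ} (hF : ContinuousAt F (a, b)) :
    CompletelyTendsto ρ (fun N x => F (g N x, h N x)) (F (a, b)) := by
  intro ε hε
  obtain ⟨δ, hδ, hδF⟩ := Metric.continuousAt_iff.1 hF ε hε
  refine ne_top_of_le_ne_top (ENNReal.add_ne_top.2 ⟨hg δ hδ, hh δ hδ⟩) ?_
  rw [← ENNReal.tsum_add]
  refine ENNReal.tsum_le_tsum fun N => (measure_mono fun x hx => ?_).trans (measure_union_le _ _)
  by_contra hn
  simp only [Set.mem_union, Set.mem_ofPred_eq, not_or, not_le] at hn hx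
  refine hx.not_gt (hδF ?_)
  rw [Prod.dist_eq]
  exact max_lt hn.1 hn.2

/-- If `f` is off by `ε`, then either the new randomness moves it by `ε / 2` from `g`, or `g` was
already off by `ε / 2`. The bound `r N` must be uniform in `x` to survive integration over `ρ N`. -/
theorem bind [∀ N, IsProbabilityMeasure (ρ N)] {B : ℕ → Type*} [∀ N, MeasurableSpace (B N)]
    {κ : ∀ N, A N → Measure (B N)} (hκ : ∀ N, Measurable (κ N)) (hg : CompletelyTendsto ρ g c)
    {f : ∀ N, B N → ℝ} (hfm : ∀ N, Measurable (f N))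
    (hdev : ∀ ε : ℝ, 0 < ε → ∃ r : ℕ → ℝ≥0∞, ∑' N, r N ≠ ∞ ∧
      ∀ N x, κ N x {y | ε ≤ |f N y - g N x|} ≤ r N)
    (hκ1 : ∀ N x, IsProbabilityMeasure (κ N x)) :
    CompletelyTendsto (fun N => (ρ N).bind (κ N)) f c := by
  intro ε hε
  obtain ⟨r, hr, hrκ⟩ := hdev (ε / 2) (half_pos hε)
  refine ne_top_of_le_ne_top (ENNReal.add_ne_top.2 ⟨hr, hg (ε / 2) (half_pos hε)⟩) ?_
  rw [← ENNReal.tsum_add]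
  refine ENNReal.tsum_le_tsum fun N => ?_
  have hm : MeasurableSet {y | ε ≤ |f N y - c|} :=
    measurableSet_le measurable_const ((hfm N).sub_const c).abs
  rw [Measure.bind_apply hm (hκ N).aemeasurable]
  calc ∫⁻ x, κ N x {y | ε ≤ |f N y - c|} ∂ρ N
      ≤ ∫⁻ x, (r N + {x | ε / 2 ≤ |g N x - c|}.indicator (fun _ => 1) x) ∂ρ N := by
        refine lintegral_mono fun x => ?_
        by_cases hx : ε / 2 ≤ |g N x - c|
        · rw [Set.indicator_of_mem (Set.mem_ofPred_eq ▸ hx)]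
          exact prob_le_one.trans le_add_self
        · refine ((measure_mono fun y hy => ?_).trans (hrκ N x)).trans le_self_add
          simp only [Set.mem_ofPred_eq] at hy ⊢
          have := abs_sub_le (f N y) (g N x) c
          linarith
    _ ≤ r N + ρ N {x | ε / 2 ≤ |g N x - c|} := by
        rw [lintegral_add_left measurable_const, lintegral_const, measure_univ, mul_one]
        gcongr
        simpa using lintegral_indicator_const_le (μ := ρ N) {x | ε / 2 ≤ |g N x - c|} 1

end CompletelyTendsto

/-! ### Hoeffding bounds for empirical means. -/

/-- The empirical mean of a function over `N` points. -/
noncomputable def empiricalMean {S : Type*} (f : S → ℝ) (N : ℕ) (x : Fin N → S) : ℝ :=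
  (∑ i, f (x i)) / N

theorem measurable_empiricalMean {S : Type*} [MeasurableSpace S] {f : S → ℝ} (hf : Measurable f)
    (N : ℕ) : Measurable (empiricalMean f N) :=
  (Finset.measurable_sum _ fun i _ => hf.comp (measurable_pi_apply i)).div_const _

/-- Hoeffding for independent draws that need not be identically distributed, as in propagation,
where each particle has its own proposal. The right side is free of `ν`, hence usable conditionally
on the previous generation. -/
theorem pi_deviation_le {S : Type*} [MeasurableSpace S] {f : S → ℝ} (hf : Measurable f)
    {C : ℝ} (hC : 0 < C) (hfC : ∀ x, |f x| ≤ C) {N : ℕ} (ν : Fin N → Measure S)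
    [∀ i, IsProbabilityMeasure (ν i)] {ε : ℝ} (hε : 0 < ε) :
    Measure.pi ν {y | ε ≤ |empiricalMean f N y - (∑ i, ∫ x, f x ∂ν i) / N|} ≤
      ENNReal.ofReal (2 * Real.exp (-(ε ^ 2 / (2 * C ^ 2))) ^ N) := by
  rcases Nat.eq_zero_or_pos N with rfl | hN
  -- For `N = 0` the bound equals `2`, so it is trivial.
  · refine prob_le_one.trans ?_
    simp
  have hN' : (0 : ℝ) < N := by exact_mod_cast hN
  have tail : ∀ F : S → ℝ, Measurable F → (∀ x, |F x| ≤ C) →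
      Measure.pi ν {y | ε * N ≤ ∑ i, (F (y i) - ∫ x, F x ∂ν i)} ≤
        ENNReal.ofReal (Real.exp (-(ε ^ 2 / (2 * C ^ 2))) ^ N) := by
    intro F hF hFC
    have hind : iIndepFun (fun i (y : Fin N → S) => F (y i) - ∫ x, F x ∂ν i) (Measure.pi ν) :=
      iIndepFun_pi (X := fun i x => F x - ∫ x, F x ∂ν i) fun i => (hF.sub_const _).aemeasurable
    have hsub : ∀ i ∈ (Finset.univ : Finset (Fin N)), HasSubgaussianMGF
        (fun (y : Fin N → S) => F (y i) - ∫ x, F x ∂ν i) ((‖C - -C‖₊ / 2) ^ 2)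
        (Measure.pi ν) := by
      intro i _
      have h := hasSubgaussianMGF_of_mem_Icc (μ := Measure.pi ν) (X := fun y => F (y i))
        (a := -C) (b := C) (hF.comp (measurable_pi_apply i)).aemeasurable
        (Eventually.of_forall fun y => abs_le.1 (hFC (y i)))
      have e : ∫ y, F (y i) ∂Measure.pi ν = ∫ x, F x ∂ν i := by
        rw [← (measurePreserving_eval ν i).map_eq, integral_map (measurable_pi_apply i).aemeasurable
          hF.aestronglyMeasurable]
      rwa [e] at h
    have h := HasSubgaussianMGF.measure_sum_ge_le_of_iIndepFun hind hsub
      (mul_nonneg hε.le hN'.le)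
    rw [← ENNReal.ofReal_toReal (measure_ne_top (Measure.pi ν) _)]
    refine ENNReal.ofReal_le_ofReal (h.trans_eq ?_)
    -- Values in `[-C, C]` give variance proxy `C ^ 2` per draw, so the exponent is `-(ε N) ^ 2 / (2
    -- N C ^ 2)`.
    rw [← Real.exp_nat_mul]
    congr 1
    have : ‖C - -C‖ = 2 * C := by
      rw [Real.norm_eq_abs, abs_of_pos (by linarith)]; ring
    simp only [Finset.sum_const, Finset.card_univ, Fintype.card_fin, NNReal.coe_pow, nsmul_eq_mul,
      NNReal.coe_mul, NNReal.coe_natCast, NNReal.coe_div, coe_nnnorm, this, NNReal.coe_ofNat]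
    field_simp
  have h1 := tail f hf hfC
  have h2 := tail (fun x => -f x) hf.neg (fun x => by rw [abs_neg]; exact hfC x)
  rw [two_mul, ENNReal.ofReal_add (by positivity) (by positivity)]
  refine ((measure_mono fun y hy => ?_).trans (measure_union_le _ _)).trans (add_le_add h1 h2)
  simp only [Set.mem_ofPred_eq, empiricalMean, ← sub_div, abs_div, Nat.abs_cast,
    le_div_iff₀ hN'] at hy
  simp only [Set.mem_union, Set.mem_ofPred_eq, integral_neg, Finset.sum_sub_distrib,
    Finset.sum_neg_distrib]
  rcases le_abs.1 hy with h | h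
  · exact Or.inl h
  · exact Or.inr (by linarith)

theorem tsum_hoeffding_ne_top {C ε : ℝ} (hC : 0 < C) (hε : 0 < ε) :
    ∑' N : ℕ, ENNReal.ofReal (2 * Real.exp (-(ε ^ 2 / (2 * C ^ 2))) ^ N) ≠ ∞ := by
  have h : Summable fun N : ℕ => 2 * Real.exp (-(ε ^ 2 / (2 * C ^ 2))) ^ N :=
    (summable_geometric_of_lt_one (Real.exp_pos _).le
      (Real.exp_lt_one_iff.2 (neg_neg_of_pos (by positivity)))).mul_left 2
  rw [← ENNReal.ofReal_tsum_of_nonneg (fun N => by positivity) h]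
  exact ENNReal.ofReal_ne_top

/-- Conditionally independent sampling preserves complete convergence of empirical means. -/
theorem CompletelyTendsto.bind_pi {A : ℕ → Type*} [∀ N, MeasurableSpace (A N)]
    {ρ : ∀ N, Measure (A N)} [∀ N, IsProbabilityMeasure (ρ N)] {S : Type*} [MeasurableSpace S]
    {κ : ∀ N, A N → Fin N → Measure S} (hκ1 : ∀ N x i, IsProbabilityMeasure (κ N x i))
    (hκ : ∀ N, Measurable fun x => Measure.pi (κ N x)) {f : S → ℝ} (hf : Measurable f)
    {C : ℝ} (hfC : ∀ x, |f x| ≤ C) {g : ∀ N, A N → ℝ} {c : ℝ}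
    (hgf : ∀ N x, g N x = (∑ i, ∫ y, f y ∂κ N x i) / N)
    (hg : CompletelyTendsto ρ g c) :
    CompletelyTendsto (fun N => (ρ N).bind fun x => Measure.pi (κ N x)) (empiricalMean f) c := by
  -- The given `C` may be `0`; the geometric bound needs a positive constant.
  have hC : 0 < |C| + 1 := by positivity
  refine hg.bind hκ (measurable_empiricalMean hf) (fun ε hε =>
    ⟨_, tsum_hoeffding_ne_top hC hε, fun N x => ?_⟩) (fun N x => inferInstance)
  rw [hgf]
  exact pi_deviation_le hf hC (fun x => ((hfC x).trans (le_abs_self C)).trans (by simp)) _ hε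

theorem completelyTendsto_pi {S : Type*} [MeasurableSpace S] (ν : Measure S)
    [IsProbabilityMeasure ν] {f : S → ℝ} (hf : Measurable f) {C : ℝ} (hfC : ∀ x, |f x| ≤ C) :
    CompletelyTendsto (fun N => Measure.pi fun _ : Fin N => ν) (empiricalMean f) (∫ x, f x ∂ν) := by
  intro ε hε
  have hC : 0 < |C| + 1 := by positivity
  refine ne_top_of_le_ne_top (tsum_hoeffding_ne_top hC hε) (ENNReal.tsum_le_tsum fun N => ?_)
  rcases Nat.eq_zero_or_pos N with rfl | hN
  -- For `N = 0` the centring `(∑ i, ∫ f) / N` is `0`, not `∫ f`, so this case is separate.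
  · refine prob_le_one.trans ?_
    simp
  · have h := pi_deviation_le hf hC
      (fun x => ((hfC x).trans (le_abs_self C)).trans (by simp)) (fun _ : Fin N => ν) hε
    have hN' : (N : ℝ) ≠ 0 := by exact_mod_cast hN.ne'
    simpa [mul_div_cancel_left₀ _ hN'] using h

/-! ### Integration against kernels, and the ratio of two Gaussian densities. -/

theorem integral_bind_of_bounded {S R : Type*} [MeasurableSpace S] [MeasurableSpace R]
    (μ : Measure S) [IsFiniteMeasure μ] {κ : S → Measure R} (hκ : Measurable κ)
    [∀ s, IsProbabilityMeasure (κ s)] {f : R → ℝ} (hf : Measurable f) {C : ℝ}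
    (hfC : ∀ x, |f x| ≤ C) : ∫ x, f x ∂μ.bind κ = ∫ s, ∫ x, f x ∂κ s ∂μ := by
  let K : Kernel S R := ⟨κ, hκ⟩
  have : IsMarkovKernel K := ⟨fun s => inferInstanceAs (IsProbabilityMeasure (κ s))⟩
  have e : (K ∘ₖ Kernel.const Unit μ) () = μ.bind κ := Kernel.comp_apply _ _ _
  have hi : Integrable f ((K ∘ₖ Kernel.const Unit μ) ()) :=
    Integrable.of_bound hf.aestronglyMeasurable C (Eventually.of_forall hfC)
  have h := Kernel.integral_comp hi
  rwa [e] at h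

theorem measurable_integral_of_measurable {S R : Type*} [MeasurableSpace S] [MeasurableSpace R]
    {κ : S → Measure R} (hκ : Measurable κ) [∀ s, IsProbabilityMeasure (κ s)] {f : R → ℝ}
    (hf : Measurable f) : Measurable fun s => ∫ x, f x ∂κ s := by
  let K : Kernel S R := ⟨κ, hκ⟩
  have : IsMarkovKernel K := ⟨fun s => inferInstanceAs (IsProbabilityMeasure (κ s))⟩
  exact (StronglyMeasurable.integral_kernel (κ := K) hf.stronglyMeasurable).measurable

theorem abs_integral_le_of_bounded {R : Type*} [MeasurableSpace R] (ν : Measure R)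
    [IsProbabilityMeasure ν] {f : R → ℝ} {C : ℝ} (hfC : ∀ x, |f x| ≤ C) : |∫ x, f x ∂ν| ≤ C := by
  simpa using norm_integral_le_of_norm_le_const (μ := ν) (f := f) (Eventually.of_forall hfC)

/-- With `r = ‖x - a‖`, Cauchy–Schwarz in the form `(r + R)² / (v + δ) ≤ r² / v + R² / δ`, for `δ =
v' - v`, bounds the difference of the exponents uniformly in `x`. -/
theorem gaussianDensity_div_le {k : ℕ} {v v' : ℝ} (hv : 0 < v) (hv' : v < v') {R : ℝ}
    {a b : EuclideanSpace ℝ (Fin k)} (hab : ‖a - b‖ ≤ R) (x : EuclideanSpace ℝ (Fin k)) :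
    gaussianDensity a v x / gaussianDensity b v' x ≤
      (√(2 * Real.pi * v))⁻¹ ^ k / (√(2 * Real.pi * v'))⁻¹ ^ k *
        Real.exp (R ^ 2 / (2 * (v' - v))) := by
  have h0 : 0 < v' := hv.trans hv'
  have hR : 0 ≤ R := (norm_nonneg _).trans hab
  have hd : 0 < v' - v := sub_pos.2 hv'
  unfold gaussianDensity
  rw [mul_div_mul_comm, ← Real.exp_sub]
  refine mul_le_mul_of_nonneg_left (Real.exp_le_exp.2 ?_) (by positivity)
  have h1 : ‖x - b‖ ≤ ‖x - a‖ + R := by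
    have := norm_add_le (x - a) (a - b)
    rw [sub_add_sub_cancel] at this
    linarith
  have h2 : ‖x - b‖ ^ 2 ≤ (‖x - a‖ + R) ^ 2 := by gcongr
  have h3 : ‖x - b‖ ^ 2 / (2 * v') ≤ (‖x - a‖ + R) ^ 2 / (2 * v') := by gcongr
  have h4 : (‖x - a‖ + R) ^ 2 / (2 * v') ≤ ‖x - a‖ ^ 2 / (2 * v) + R ^ 2 / (2 * (v' - v)) := by
    rw [div_add_div _ _ (by positivity) (by positivity),
      div_le_div_iff₀ (by positivity) (by positivity)]
    -- After clearing denominators, the difference of the two sides is a positive multiple of this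
    -- square.
    nlinarith [sq_nonneg (‖x - a‖ * (v' - v) - R * v)]
  rw [neg_div, neg_div]
  linarith

theorem lintegral_withDensity_ofReal {S : Type*} [MeasurableSpace S] (μ : Measure S) {w : S → ℝ}
    (hw : Measurable w) {F : S → ℝ≥0∞} (hF : Measurable F) :
    ∫⁻ x, F x ∂μ.withDensity (fun x => ENNReal.ofReal (w x)) =
      ∫⁻ x, ENNReal.ofReal (w x) * F x ∂μ :=
  lintegral_withDensity_eq_lintegral_mul _ hw.ennreal_ofReal hF

/-! ### Path densities and the recursion of the target measures. -/

namespace LDSMC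

section Targets

variable {d n m : ℕ}

theorem lintegral_fin_cons {s : ℕ}
    {F : (Fin (s + 2) → EuclideanSpace ℝ (Fin d)) → ℝ≥0∞} (hF : Measurable F) :
    ∫⁻ z, F z = ∫⁻ p : Fin (s + 1) → EuclideanSpace ℝ (Fin d),
      ∫⁻ x : EuclideanSpace ℝ (Fin d), F (Fin.cons x p) := by
  have hv := (volume_preserving_piFinSuccAbove
    (fun _ : Fin (s + 2) => EuclideanSpace ℝ (Fin d)) 0).symm
  rw [← hv.lintegral_comp hF, Measure.volume_eq_prod,
    lintegral_prod_symm]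
  · refine lintegral_congr fun p => lintegral_congr fun x => congrArg F ?_
    exact Fin.insertNth_zero' x p
  · exact (hF.comp (MeasurableEquiv.measurable _)).aemeasurable

variable (M : LDSMC d n m)

theorem measurable_trans (t : ℕ) {S : Type*} [MeasurableSpace S]
    {f g : S → EuclideanSpace ℝ (Fin d)} (hf : Measurable f) (hg : Measurable g) :
    Measurable fun s => M.trans t (f s) (g s) :=
  measurable_gaussianDensity ((M.measurable_μ (t + 1)).comp hf) hg _

theorem lintegral_extend {t s : ℕ} (p : Fin (s + 1) → EuclideanSpace ℝ (Fin d))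
    {F : (Fin (s + 2) → EuclideanSpace ℝ (Fin d)) → ℝ≥0∞} (hF : Measurable F) :
    ∫⁻ z, F z ∂M.extend t s p =
      ∫⁻ x, ENNReal.ofReal (M.propDensity t (p 0) x) * F (Fin.cons x p) := by
  have hc : Measurable fun z =>
      (Fin.cons z p : Fin (s + 2) → EuclideanSpace ℝ (Fin d)) :=
    (measurable_cons s).comp (measurable_const.prodMk measurable_id)
  rw [extend, lintegral_map hF hc, propMeasure, gaussianMeasure,
    lintegral_withDensity_ofReal _
      (show Measurable fun x => gaussianDensity (M.propMean t (p 0)) (M.σ' (t + 1) ^ 2) x from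
        measurable_gaussianDensity measurable_const measurable_id _)
      (show Measurable fun x => F (Fin.cons x p) from hF.comp hc)]
  rfl

/-- The unnormalized target density of the path `z_{t:T}` after `s` steps, at time `t = T - s`. -/
noncomputable def pathDensity (s : ℕ) (z : Fin (s + 1) → EuclideanSpace ℝ (Fin d)) : ℝ :=
  gaussianDensity 0 1 (z (Fin.last s)) *
    (∏ k : Fin s, M.trans (M.T - s + k) (z k.succ) (z k.castSucc)) *
    (∏ k : Fin (s + 1), M.lik (M.T - s + k) (z k)) *
    -- `pbar` stands in for the likelihood of `y 0`, which enters only at time `0`, as the factor `k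
    -- = 0` of the product above.
    if s = M.T then 1 else M.pbar (M.T - s) (z 0)

theorem measurable_pathDensity (s : ℕ) : Measurable (M.pathDensity s) := by
  have e : ∀ i, Measurable fun z : Fin (s + 1) → EuclideanSpace ℝ (Fin d) => z i :=
    fun i => measurable_pi_apply i
  refine Measurable.mul (Measurable.mul (Measurable.mul ?_ ?_) ?_) ?_
  · exact measurable_gaussianDensity measurable_const (e _) _
  · exact Finset.measurable_prod _ fun k _ => M.measurable_trans _ (e _) (e _)
  · exact Finset.measurable_prod _ fun k _ => (M.measurable_lik _).comp (e k)
  · split_ifs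
    · exact measurable_const
    · exact (M.measurable_pbar _).comp (e 0)

theorem lik_pos (t : ℕ) (z : EuclideanSpace ℝ (Fin d)) : 0 < M.lik t z :=
  gaussianDensity_pos _ _ (pow_pos M.τ_pos 2)

theorem pbar_pos {t : ℕ} (h1 : 1 ≤ t) (hT : t ≤ M.T) (z : EuclideanSpace ℝ (Fin d)) :
    0 < M.pbar t z :=
  gaussianDensity_pos _ _ (sub_pos.2 (M.abar_lt_one h1 hT))

theorem trans_pos {t : ℕ} (hT : t < M.T) (u z : EuclideanSpace ℝ (Fin d)) : 0 < M.trans t u z :=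
  gaussianDensity_pos _ _ (pow_pos (M.σ_pos _ (by omega) hT) 2)

theorem propDensity_pos {t : ℕ} (hT : t < M.T) (u z : EuclideanSpace ℝ (Fin d)) :
    0 < M.propDensity t u z :=
  gaussianDensity_pos _ _ (pow_pos (M.σ'_pos _ (by omega) hT) 2)

theorem pathDensity_pos {s : ℕ} (hs : s ≤ M.T) (z : Fin (s + 1) → EuclideanSpace ℝ (Fin d)) :
    0 < M.pathDensity s z := by
  refine mul_pos (mul_pos (mul_pos (gaussianDensity_pos _ _ one_pos) ?_) ?_) ?_
  · exact Finset.prod_pos fun k _ => M.trans_pos (by omega) _ _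
  · exact Finset.prod_pos fun k _ => M.lik_pos _ _
  · split_ifs with h
    · exact one_pos
    · exact M.pbar_pos (by omega) (by omega) _

theorem pathDensity_zero (z : Fin 1 → EuclideanSpace ℝ (Fin d)) :
    M.pathDensity 0 z = gaussianDensity 0 1 (z 0) * M.pathWeight 0 z := by
  have h : 0 ≠ M.T := by have := M.one_le_T; omega
  simp [pathDensity, pathWeight, weightT, h, mul_assoc]

/-- The telescoping identity: the weight divides out the proposal density and the endpoint factor
`pbar` of the shorter path, then inserts the transition, the likelihood and the new endpoint factor.
-/
theorem pathDensity_cons {s : ℕ} (hs : s + 1 ≤ M.T) (x : EuclideanSpace ℝ (Fin d))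
    (p : Fin (s + 1) → EuclideanSpace ℝ (Fin d)) :
    M.pathDensity (s + 1) (Fin.cons x p) =
      M.pathDensity s p * (M.propDensity (M.T - (s + 1)) (p 0) x *
        M.pathWeight (s + 1) (Fin.cons x p)) := by
  have hst : s ≠ M.T := by omega
  have hq := (M.propDensity_pos (t := M.T - (s + 1)) (by omega) (p 0) x).ne'
  have hp := (M.pbar_pos (t := M.T - s) (by omega) (by omega) (p 0)).ne'
  -- Entry `k + 1` of the longer path lives at the same time as entry `k` of the shorter one.
  have e : ∀ k : ℕ, M.T - (s + 1) + (k + 1) = M.T - s + k := fun k => by omega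
  have c1 : (Fin.cons x p : Fin (s + 2) → EuclideanSpace ℝ (Fin d)) 1 = p 0 := rfl
  have c2 : (Fin.cons x p : Fin (s + 2) → EuclideanSpace ℝ (Fin d)) (Fin.last (s + 1)) =
    p (Fin.last s) := rfl
  simp only [pathDensity, pathWeight, weight, Fin.prod_univ_succ (n := s),
    Fin.prod_univ_succ (n := s + 1), Fin.cons_succ, Fin.cons_zero, Fin.castSucc_zero,
    ← Fin.succ_castSucc, Fin.val_zero, Fin.val_succ, e, c1, c2, hst, if_false, add_zero]
  by_cases h : s + 1 = M.T
  · have h0 : M.T - (s + 1) = 0 := by omega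
    have h1 : M.T - s = 1 := by omega
    rw [h0] at hq
    rw [h1] at hp
    simp only [if_pos h, h0, h1, if_pos]
    field_simp
  · have h0 : M.T - (s + 1) ≠ 0 := by omega
    simp only [h, h0, if_false]
    field_simp

/-- The unnormalized filtering measure of the path after `s` steps. -/
noncomputable def filterMeasure (s : ℕ) : Measure (Fin (s + 1) → EuclideanSpace ℝ (Fin d)) :=
  volume.withDensity fun z => ENNReal.ofReal (M.pathDensity s z)

/-- The unnormalized predictive measure of the path after `s` steps, before the weights of that
step are taken into account. -/
noncomputable def predMeasure : (s : ℕ) → Measure (Fin (s + 1) → EuclideanSpace ℝ (Fin d))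
  | 0 => (gaussianMeasure 0 1).map fun z => (fun _ => z : Fin 1 → EuclideanSpace ℝ (Fin d))
  | s + 1 => (M.filterMeasure s).bind (M.extend (M.T - (s + 1)) s)

/-- This ties the sampler's dynamics to the closed-form density. No induction hypothesis is needed,
since `predMeasure (s + 1)` is built from `filterMeasure s`, whose density is explicit. -/
theorem predMeasure_withDensity :
    ∀ s, s ≤ M.T → (M.predMeasure s).withDensity (fun z => ENNReal.ofReal (M.pathWeight s z)) =
      M.filterMeasure s
  | 0, _ => by
    have hw := (M.measurable_pathWeight 0)
    have hc : Measurable fun z => (fun _ => z : Fin 1 → EuclideanSpace ℝ (Fin d)) :=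
      measurable_pi_lambda _ fun _ => measurable_id
    have hg : Measurable fun x : EuclideanSpace ℝ (Fin d) =>
        gaussianDensity 0 1 x :=
      measurable_gaussianDensity measurable_const measurable_id _
    refine Measure.ext_of_lintegral _ fun f hf => ?_
    have hv := (volume_preserving_funUnique (Fin 1) (EuclideanSpace ℝ (Fin d))).symm
    have hp := M.measurable_pathDensity 0
    have hwf : Measurable fun z => ENNReal.ofReal (M.pathWeight 0 z) * f z :=
      hw.ennreal_ofReal.mul hf
    have hpf : Measurable fun z => ENNReal.ofReal (M.pathDensity 0 z) * f z :=
      hp.ennreal_ofReal.mul hf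
    rw [lintegral_withDensity_ofReal _ hw hf, predMeasure, lintegral_map hwf hc, gaussianMeasure,
      lintegral_withDensity_ofReal _ hg (show Measurable fun x : EuclideanSpace ℝ (Fin d) =>
        ENNReal.ofReal (M.pathWeight 0 fun _ => x) * f fun _ => x from hwf.comp hc), filterMeasure,
      lintegral_withDensity_ofReal _ hp hf]
    refine Eq.trans ?_ (hv.lintegral_comp hpf)
    refine lintegral_congr fun x => ?_
    rw [← mul_assoc,
      ← ENNReal.ofReal_mul (gaussianDensity_pos _ _ one_pos).le, pathDensity_zero]
    rfl
  | s + 1, hs => by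
    have hw := M.measurable_pathWeight (s + 1)
    refine Measure.ext_of_lintegral _ fun f hf => ?_
    have hwf : Measurable fun z => ENNReal.ofReal (M.pathWeight (s + 1) z) * f z :=
      hw.ennreal_ofReal.mul hf
    have hp := M.measurable_pathDensity s
    have hp' := M.measurable_pathDensity (s + 1)
    have hK : Measurable fun p => ∫⁻ z, ENNReal.ofReal (M.pathWeight (s + 1) z) * f z
        ∂M.extend (M.T - (s + 1)) s p :=
      (Measure.measurable_lintegral hwf).comp (M.measurable_extend _ s)
    rw [lintegral_withDensity_ofReal _ hw hf, predMeasure,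
      Measure.lintegral_bind (M.measurable_extend _ s).aemeasurable hwf.aemeasurable,
      filterMeasure, filterMeasure, lintegral_withDensity_ofReal _ hp' hf,
      lintegral_fin_cons (show Measurable fun z => ENNReal.ofReal (M.pathDensity (s + 1) z) * f z
        from hp'.ennreal_ofReal.mul hf), lintegral_withDensity_ofReal _ hp hK]
    refine lintegral_congr fun p => ?_
    rw [M.lintegral_extend p hwf, ← lintegral_const_mul' _ _ ENNReal.ofReal_ne_top]
    refine lintegral_congr fun x => ?_
    rw [M.pathDensity_cons hs, ENNReal.ofReal_mul (M.pathDensity_pos (by omega) p).le,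
      ENNReal.ofReal_mul (M.propDensity_pos (by omega) _ _).le, mul_assoc, mul_assoc]

theorem filterMeasure_ne_zero {s : ℕ} (hs : s ≤ M.T) : M.filterMeasure s ≠ 0 := by
  intro h
  rw [filterMeasure, withDensity_eq_zero_iff
    (M.measurable_pathDensity s).ennreal_ofReal.aemeasurable] at h
  have hF : ∀ᵐ _ : Fin (s + 1) → EuclideanSpace ℝ (Fin d), False := by
    filter_upwards [h] with z hz
    exact (ENNReal.ofReal_pos.2 (M.pathDensity_pos hs z)).ne' hz
  rw [ae_iff] at hF
  simp only [not_false_eq_true, Set.ofPred_true, Measure.measure_univ_eq_zero] at hF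
  exact NeZero.ne (volume : Measure (Fin (s + 1) → EuclideanSpace ℝ (Fin d))) hF

theorem jointDensity_eq (z : Fin (M.T + 1) → EuclideanSpace ℝ (Fin d)) :
    M.jointDensity z = M.pathDensity M.T z := by
  simp [jointDensity, pathDensity]

theorem filterMeasure_univ : M.filterMeasure M.T Set.univ = M.evidence := by
  rw [filterMeasure, withDensity_apply _ MeasurableSet.univ, Measure.restrict_univ, evidence]
  simp_rw [jointDensity_eq]

theorem posterior_eq : M.posterior = M.evidence⁻¹ • M.filterMeasure M.T := by
  rw [posterior, filterMeasure, ← withDensity_smul _ (M.measurable_pathDensity _).ennreal_ofReal]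
  congr 1
  ext z
  rw [jointDensity_eq, ENNReal.div_eq_inv_mul]
  rfl

end Targets

/-! ### Bounded weights and convergence of the particle system. -/

section Convergence

variable {d n m : ℕ} (M : LDSMC d n m)

theorem exists_norm_sub_propMean_le {t : ℕ} (ht : t < M.T)
    (hb : HasBoundedGradient (M.logPbar (t + 1))) (hc : HasBoundedGradient (M.logQ t)) :
    ∃ R, ∀ z, ‖M.μ (t + 1) z - M.propMean t z‖ ≤ R := by
  obtain ⟨-, -, B, hB⟩ := hb
  obtain ⟨-, -, C, hC⟩ := hc
  obtain ⟨G, hG⟩ := M.bounded_γ t ht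
  obtain ⟨L, hL⟩ := M.bounded_lam t ht
  refine ⟨G * B + L * C, fun z => ?_⟩
  rw [propMean, sub_sub_cancel]
  refine (norm_add_le _ _).trans (add_le_add ?_ ?_)
  · rw [norm_smul]
    exact mul_le_mul (hG z) (hB z) (norm_nonneg _) ((abs_nonneg _).trans (hG z))
  · rw [norm_smul]
    exact mul_le_mul (hL z) (hC _) (norm_nonneg _) ((abs_nonneg _).trans (hL z))

theorem exists_trans_div_propDensity_le {t : ℕ} (ht : t < M.T)
    (hb : HasBoundedGradient (M.logPbar (t + 1))) (hc : HasBoundedGradient (M.logQ t))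
    (hd : M.σ (t + 1) ^ 2 < M.σ' (t + 1) ^ 2) :
    ∃ C, ∀ z' z, M.trans t z' z / M.propDensity t z' z ≤ C := by
  obtain ⟨R, hR⟩ := M.exists_norm_sub_propMean_le ht hb hc
  exact ⟨_, fun z' z => gaussianDensity_div_le (pow_pos (M.σ_pos _ (by omega) ht) 2) hd (hR z') z⟩

/-- After the initial step each weight is a product of factors bounded by (a) and the ratio of
transition to proposal, bounded by (b), (c) and (d). -/
theorem exists_pathWeight_le (ha_lik : ∀ t, t ≤ M.T → PosBounded (M.lik t))
    (ha_ratio : ∀ t, 1 ≤ t → t < M.T →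
      PosBounded fun p : EuclideanSpace ℝ (Fin d) × EuclideanSpace ℝ (Fin d) =>
        M.pbar t p.1 / M.pbar (t + 1) p.2)
    (ha_ratio_zero :
      PosBounded fun p : EuclideanSpace ℝ (Fin d) × EuclideanSpace ℝ (Fin d) =>
        M.lik 0 p.1 / M.pbar 1 p.2)
    (ha_T : PosBounded (M.pbar M.T))
    (hb : ∀ t, 1 ≤ t → t ≤ M.T → HasBoundedGradient (M.logPbar t))
    (hc : ∀ t, t < M.T → HasBoundedGradient (M.logQ t))
    (hd : ∀ t, 1 ≤ t → t ≤ M.T → M.σ t ^ 2 < M.σ' t ^ 2) {s : ℕ} (hs : s ≤ M.T) :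
    ∃ C, ∀ z, M.pathWeight s z ≤ C := by
  have hT := M.one_le_T
  cases s with
  | zero =>
    obtain ⟨hl, A, hA⟩ := ha_lik M.T le_rfl
    obtain ⟨hp, B, hB⟩ := ha_T
    exact ⟨A * B, fun z => mul_le_mul (hA _) (hB _) (hp _).le ((hl (z 0)).le.trans (hA _))⟩
  | succ s =>
    have ht : M.T - (s + 1) < M.T := by omega
    obtain ⟨C, hC⟩ := M.exists_trans_div_propDensity_le ht (hb _ (by omega) (by omega))
      (hc _ ht) (hd _ (by omega) (by omega))
    have hr : ∀ u v, 0 < M.trans (M.T - (s + 1)) u v / M.propDensity (M.T - (s + 1)) u v :=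
      fun u v => div_pos (M.trans_pos ht u v) (M.propDensity_pos ht u v)
    by_cases h : M.T - (s + 1) = 0
    · obtain ⟨hl, A, hA⟩ := ha_ratio_zero
      rw [h] at hC hr
      refine ⟨A * C, fun z => ?_⟩
      rw [pathWeight, weight, if_pos h, mul_div_mul_comm]
      exact mul_le_mul (hA (z 0, z 1)) (hC _ _) (hr _ _).le
        ((hl (z 0, z 1)).le.trans (hA (z 0, z 1)))
    · obtain ⟨hl, A, hA⟩ := ha_lik (M.T - (s + 1)) ht.le
      obtain ⟨hp, B, hB⟩ := ha_ratio (M.T - (s + 1)) (by omega) ht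
      refine ⟨A * B * C, fun z => ?_⟩
      rw [pathWeight, weight, if_neg h, mul_div_mul_comm, mul_div_assoc]
      have hA0 := (hl (z 0)).le.trans (hA (z 0))
      have hB0 := (hp (z 0, z 1)).le.trans (hB (z 0, z 1))
      exact mul_le_mul (mul_le_mul (hA _) (hB (z 0, z 1)) (hp (z 0, z 1)).le hA0) (hC _ _)
        (hr _ _).le (mul_nonneg hA0 hB0)

theorem integral_particleMeasure (s : ℕ) {N : ℕ}
    (x : Fin N → Fin (s + 1) → EuclideanSpace ℝ (Fin d))
    {f : (Fin (s + 1) → EuclideanSpace ℝ (Fin d)) → ℝ} (hf : Measurable f)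
    (hw : ∀ z, 0 < M.pathWeight s z) :
    ∫ z, f z ∂M.particleMeasure s x =
      empiricalMean (fun z => M.pathWeight s z * f z) N x / empiricalMean (M.pathWeight s) N x := by
  rcases Nat.eq_zero_or_pos N with rfl | hN
  -- Without particles the measure is zero and the right side is `0 / 0 = 0`.
  · simp [particleMeasure, empiricalMean]
  have hN' : (N : ℝ) ≠ 0 := by exact_mod_cast hN.ne'
  rw [particleMeasure, integral_finsetSum_measure, empiricalMean, empiricalMean,
    div_div_div_cancel_right₀ hN', Finset.sum_div]
  · refine Finset.sum_congr rfl fun i _ => ?_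
    rw [integral_smul_measure, integral_dirac' _ _ hf.stronglyMeasurable, normWeight,
      ENNReal.toReal_ofReal, smul_eq_mul, div_mul_eq_mul_div]
    exact div_nonneg (hw _).le (Finset.sum_nonneg fun j _ => (hw _).le)
  · exact fun i _ => ((integrable_dirac' hf.stronglyMeasurable) (by simp)).smul_measure
      ENNReal.ofReal_ne_top

/-- Self-normalization is a quotient of two empirical means, and division is continuous at the limit
because positive weights have a positive mean. The normalizing constant of `predMeasure s` cancels
in the quotient. -/
theorem completelyTendsto_particleMeasure {s : ℕ} (hs : s ≤ M.T)
    (hW : ∃ C, ∀ z, M.pathWeight s z ≤ C) [IsFiniteMeasure (M.predMeasure s)]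
    (hemp : ∀ f : (Fin (s + 1) → EuclideanSpace ℝ (Fin d)) → ℝ, Measurable f →
      (∃ C, ∀ z, |f z| ≤ C) → CompletelyTendsto (fun N => M.sisrLaw N s) (empiricalMean f)
        (⨍ z, f z ∂M.predMeasure s))
    {f : (Fin (s + 1) → EuclideanSpace ℝ (Fin d)) → ℝ} (hf : Measurable f)
    (hfC : ∃ C, ∀ z, |f z| ≤ C) :
    CompletelyTendsto (fun N => M.sisrLaw N s) (fun _ x => ∫ z, f z ∂M.particleMeasure s x)
      (⨍ z, f z ∂M.filterMeasure s) := by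
  obtain ⟨W, hW⟩ := hW
  obtain ⟨C, hC⟩ := hfC
  have hpos := M.pathWeight_pos hs
  have hwm := M.measurable_pathWeight s
  have hWabs : ∀ z, |M.pathWeight s z| ≤ W := fun z => by
    rw [abs_of_pos (hpos z)]; exact hW z
  have h1 := hemp _ (hwm.mul hf) ⟨W * C, fun z => by
    rw [Pi.mul_apply, abs_mul]
    exact mul_le_mul (hWabs z) (hC z) (abs_nonneg _) ((abs_nonneg _).trans (hWabs z))⟩
  have h2 := hemp _ hwm ⟨W, hWabs⟩
  have hint : ∀ F : (Fin (s + 1) → EuclideanSpace ℝ (Fin d)) → ℝ,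
      ∫ z, F z ∂M.filterMeasure s = ∫ z, M.pathWeight s z * F z ∂M.predMeasure s := by
    intro F
    rw [← M.predMeasure_withDensity s hs,
      integral_withDensity_eq_integral_toReal_smul hwm.ennreal_ofReal
        (Eventually.of_forall fun _ => ENNReal.ofReal_lt_top)]
    simp only [ENNReal.toReal_ofReal (hpos _).le, smul_eq_mul]
  have hU : M.predMeasure s ≠ 0 := by
    intro h
    apply M.filterMeasure_ne_zero hs
    rw [← M.predMeasure_withDensity s hs, h]
    simp
  have hU' : (M.predMeasure s).real Set.univ ≠ 0 := by
    simpa [measureReal_def, ENNReal.toReal_eq_zero_iff] using hU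
  have hw1 : 0 < ∫ z, M.pathWeight s z ∂M.predMeasure s := by
    rw [integral_pos_iff_support_of_nonneg (fun z => (hpos z).le)
      (Integrable.of_bound hwm.aestronglyMeasurable W (Eventually.of_forall hWabs))]
    have : Function.support (M.pathWeight s) = Set.univ :=
      Set.eq_univ_of_forall fun z => (hpos z).ne'
    rw [this]
    exact Measure.measure_univ_pos.2 hU
  have hreal : (M.filterMeasure s).real Set.univ = ∫ z, M.pathWeight s z ∂M.predMeasure s := by
    have := hint fun _ => 1
    simpa using this
  have hb0 : ⨍ z, M.pathWeight s z ∂M.predMeasure s ≠ 0 := by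
    rw [average_eq, smul_eq_mul]
    exact mul_ne_zero (inv_ne_zero hU') hw1.ne'
  have h3 := h1.continuousAt_comp₂ h2 (F := fun p => p.1 / p.2)
    (continuousAt_fst.div continuousAt_snd hb0)
  have e : ⨍ z, f z ∂M.filterMeasure s =
      (⨍ z, (M.pathWeight s * f) z ∂M.predMeasure s) / ⨍ z, M.pathWeight s z ∂M.predMeasure s := by
    rw [average_eq, average_eq, average_eq, hreal, hint f]
    simp only [smul_eq_mul, Pi.mul_apply]
    field_simp
  rw [e]
  convert h3 using 3 with N x
  exact M.integral_particleMeasure s x hf hpos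

/-- Propagation preserves total mass, so both averages have the same normalizing constant. -/
theorem predMeasure_step {s : ℕ} (hs : s + 1 ≤ M.T) [IsFiniteMeasure (M.filterMeasure s)]
    {f : (Fin (s + 2) → EuclideanSpace ℝ (Fin d)) → ℝ} (hf : Measurable f)
    {C : ℝ} (hfC : ∀ z, |f z| ≤ C) :
    ⨍ z, f z ∂M.predMeasure (s + 1) =
      ⨍ p, ∫ z, f z ∂M.extend (M.T - (s + 1)) s p ∂M.filterMeasure s := by
  have hK := M.measurable_extend (M.T - (s + 1)) s
  have := fun p => M.isProbabilityMeasure_extend (t := M.T - (s + 1)) (by omega) s p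
  have h1 := integral_bind_of_bounded (M.filterMeasure s) hK hf hfC
  have h2 := integral_bind_of_bounded (M.filterMeasure s) hK (f := fun _ => (1 : ℝ))
    measurable_const (C := 1) (by simp)
  simp only [integral_const, smul_eq_mul, mul_one, probReal_univ] at h2
  rw [average_eq, average_eq, predMeasure, h1, h2]

theorem isFiniteMeasure_filterMeasure {s : ℕ} (hs : s ≤ M.T)
    (hW : ∃ C, ∀ z, M.pathWeight s z ≤ C) [IsFiniteMeasure (M.predMeasure s)] :
    IsFiniteMeasure (M.filterMeasure s) := by
  obtain ⟨C, hC⟩ := hW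
  rw [← M.predMeasure_withDensity s hs]
  refine isFiniteMeasure_withDensity (ne_top_of_le_ne_top ?_
    (lintegral_mono fun z => ENNReal.ofReal_le_ofReal (hC z)))
  rw [lintegral_const]
  exact ENNReal.mul_ne_top ENNReal.ofReal_ne_top (measure_ne_top _ _)

theorem isFiniteMeasure_predMeasure
    (hW : ∀ s, s ≤ M.T → ∃ C, ∀ z, M.pathWeight s z ≤ C) :
    ∀ s, s ≤ M.T → IsFiniteMeasure (M.predMeasure s)
  | 0, _ => by
    have := isProbabilityMeasure_gaussianMeasure (0 : EuclideanSpace ℝ (Fin d)) one_pos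
    rw [predMeasure]
    infer_instance
  | s + 1, hs => by
    have := isFiniteMeasure_predMeasure hW s (by omega)
    have := M.isFiniteMeasure_filterMeasure (by omega) (hW s (by omega))
    have := fun p => M.isProbabilityMeasure_extend (t := M.T - (s + 1)) (by omega) s p
    constructor
    rw [predMeasure, Measure.bind_apply MeasurableSet.univ (M.measurable_extend _ s).aemeasurable]
    simp

/-- The test function is pulled back through the step: given the resampled paths, the mean of `f`
after propagation is the empirical mean of `p ↦ ∫ f ∂(extend p)`, and the mean of that under
resampling is its integral against `particleMeasure`. Each stage adds one Hoeffding error. -/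
theorem completelyTendsto_empiricalMean_succ
    (hW : ∀ s, s ≤ M.T → ∃ C, ∀ z, M.pathWeight s z ≤ C) {s : ℕ} (hs : s + 1 ≤ M.T)
    (hemp : ∀ f : (Fin (s + 1) → EuclideanSpace ℝ (Fin d)) → ℝ, Measurable f →
      (∃ C, ∀ z, |f z| ≤ C) → CompletelyTendsto (fun N => M.sisrLaw N s) (empiricalMean f)
        (⨍ z, f z ∂M.predMeasure s))
    {f : (Fin (s + 2) → EuclideanSpace ℝ (Fin d)) → ℝ} (hf : Measurable f)
    {C : ℝ} (hC : ∀ z, |f z| ≤ C) :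
    CompletelyTendsto (fun N => M.sisrLaw N (s + 1)) (empiricalMean f)
      (⨍ z, f z ∂M.predMeasure (s + 1)) := by
  have hs' : s ≤ M.T := by omega
  have ht : M.T - (s + 1) < M.T := by omega
  have := M.isFiniteMeasure_predMeasure hW s hs'
  have := M.isFiniteMeasure_filterMeasure hs' (hW s hs')
  have hext := fun p => M.isProbabilityMeasure_extend ht s p
  have hlaw := fun N => M.isProbabilityMeasure_sisrLaw N s hs'
  have hres : ∀ N (x : Fin N → Fin (s + 1) → EuclideanSpace ℝ (Fin d)) (_ : Fin N),
      IsProbabilityMeasure (M.particleMeasure s x) := fun N x i =>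
    M.isProbabilityMeasure_particleMeasure hs' i.pos x
  have hres' : ∀ N (x : Fin N → Fin (s + 1) → EuclideanSpace ℝ (Fin d)),
      IsProbabilityMeasure (M.resample s x) := fun N x => by
    have := hres N x
    unfold resample
    infer_instance
  have hlaw' : ∀ N, IsProbabilityMeasure ((M.sisrLaw N s).bind (M.resample s)) := fun N =>
    isProbabilityMeasure_bind (M.measurable_resample s N).aemeasurable
      (Eventually.of_forall (hres' N))
  have hgm := measurable_integral_of_measurable (M.measurable_extend (M.T - (s + 1)) s) hf
  have hgC := fun p => abs_integral_le_of_bounded (M.extend (M.T - (s + 1)) s p) hC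
  rw [M.predMeasure_step hs hf hC]
  have h1 := M.completelyTendsto_particleMeasure hs' (hW s hs')
    hemp hgm ⟨C, hgC⟩
  have h2 : CompletelyTendsto (fun N => (M.sisrLaw N s).bind (M.resample s))
      (empiricalMean fun p => ∫ z, f z ∂M.extend (M.T - (s + 1)) s p)
      (⨍ p, ∫ z, f z ∂M.extend (M.T - (s + 1)) s p ∂M.filterMeasure s) := by
    refine CompletelyTendsto.bind_pi (ρ := fun N => M.sisrLaw N s)
      (κ := fun _ x _ => M.particleMeasure s x)
      (g := fun _ x => ∫ p, ∫ z, f z ∂M.extend (M.T - (s + 1)) s p ∂M.particleMeasure s x) hres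
      (fun N => M.measurable_resample s N) hgm hgC (fun N x => ?_) h1
    rcases Nat.eq_zero_or_pos N with rfl | hN
    · simp [particleMeasure]
    · have hN' : (N : ℝ) ≠ 0 := by exact_mod_cast hN.ne'
      simp [mul_div_cancel_left₀ _ hN']
  exact CompletelyTendsto.bind_pi (ρ := fun N => (M.sisrLaw N s).bind (M.resample s))
    (κ := fun _ x i => M.extend (M.T - (s + 1)) s (x i))
    (g := empiricalMean fun p => ∫ z, f z ∂M.extend (M.T - (s + 1)) s p)
    (fun N x i => hext (x i)) (fun N => M.measurable_propagate ht s N) hf hC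
    (fun N x => rfl) h2

/-- Before weighting, the empirical means of the particles converge to the normalized predictive
measure. -/
theorem completelyTendsto_empiricalMean
    (hW : ∀ s, s ≤ M.T → ∃ C, ∀ z, M.pathWeight s z ≤ C) {s : ℕ} (hs : s ≤ M.T) :
    ∀ f : (Fin (s + 1) → EuclideanSpace ℝ (Fin d)) → ℝ, Measurable f →
      (∃ C, ∀ z, |f z| ≤ C) → CompletelyTendsto (fun N => M.sisrLaw N s) (empiricalMean f)
        (⨍ z, f z ∂M.predMeasure s) := by
  induction s with
  | zero =>
    rintro f hf ⟨C, hC⟩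
    have := isProbabilityMeasure_gaussianMeasure (0 : EuclideanSpace ℝ (Fin d)) one_pos
    have : IsProbabilityMeasure ((gaussianMeasure (0 : EuclideanSpace ℝ (Fin d)) 1).map
        fun z => (fun _ => z : Fin 1 → EuclideanSpace ℝ (Fin d))) :=
      Measure.isProbabilityMeasure_map
        (measurable_pi_lambda _ fun _ => measurable_id).aemeasurable
    rw [predMeasure, average_eq_integral]
    exact completelyTendsto_pi _ hf hC
  | succ s ih =>
    rintro f hf ⟨C, hC⟩
    exact M.completelyTendsto_empiricalMean_succ hW hs (ih (by omega)) hf hC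

theorem particleMeasure_eq_ofReal_integral (s : ℕ) {N : ℕ}
    (x : Fin N → Fin (s + 1) → EuclideanSpace ℝ (Fin d))
    {E : Set (Fin (s + 1) → EuclideanSpace ℝ (Fin d))} (hE : MeasurableSet E) :
    M.particleMeasure s x E =
      ENNReal.ofReal (∫ z, E.indicator (fun _ => (1 : ℝ)) z ∂M.particleMeasure s x) := by
  rw [integral_indicator_const _ hE, smul_eq_mul, mul_one, ofReal_measureReal]

end Convergence

end LDSMC

/-! ### The posterior and almost sure convergence. -/

theorem mainTheorem1 {d n m : ℕ} (M : LDSMC d n m)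
    -- (a) the likelihoods, the ratios of consecutive `p̄` terms (with the true likelihood of `y 0`
    -- in the numerator at the last step) and `p̄` at time `T` are positive and bounded
    (ha_lik : ∀ t, t ≤ M.T → PosBounded (M.lik t))
    (ha_ratio : ∀ t, 1 ≤ t → t < M.T →
      PosBounded fun p : EuclideanSpace ℝ (Fin d) × EuclideanSpace ℝ (Fin d) =>
        M.pbar t p.1 / M.pbar (t + 1) p.2)
    (ha_ratio_zero :
      PosBounded fun p : EuclideanSpace ℝ (Fin d) × EuclideanSpace ℝ (Fin d) =>
        M.lik 0 p.1 / M.pbar 1 p.2)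
    (ha_T : PosBounded (M.pbar M.T))
    -- (b), (c) the log terms of the proposal mean are continuous with bounded gradients
    (hb : ∀ t, 1 ≤ t → t ≤ M.T → HasBoundedGradient (M.logPbar t))
    (hc : ∀ t, t < M.T → HasBoundedGradient (M.logQ t))
    -- (d) the proposal variance is larger than the prior variance
    (hd : ∀ t, 1 ≤ t → t ≤ M.T → M.σ t ^ 2 < M.σ' t ^ 2)
    -- for each `N`, `X N` are the particles returned by the procedure run with `N` particles;
    -- the joint law of the runs for different `N` is arbitrary
    {Ω : Type*} [MeasurableSpace Ω] (P : Measure Ω) [IsProbabilityMeasure P]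
    (X : (N : ℕ) → Ω → Fin N → Fin (M.T + 1) → EuclideanSpace ℝ (Fin d))
    (hX : ∀ N, HasLaw (X N) (M.sisrLaw N M.T) P) :
    IsProbabilityMeasure M.posterior ∧
    ∀ E : Set (Fin (M.T + 1) → EuclideanSpace ℝ (Fin d)), NullMeasurableSet E M.posterior →
      ∀ᵐ ω ∂P, Tendsto (fun N : ℕ => M.particleMeasure M.T (X N ω) E) atTop
        (𝓝 (M.posterior E)) := by
  have hW : ∀ s, s ≤ M.T → ∃ C, ∀ z, M.pathWeight s z ≤ C := fun s hs =>
    M.exists_pathWeight_le ha_lik ha_ratio ha_ratio_zero ha_T hb hc hd hs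
  have hU := M.isFiniteMeasure_predMeasure hW M.T le_rfl
  have hF := M.isFiniteMeasure_filterMeasure le_rfl (hW M.T le_rfl)
  have h0 : M.evidence ≠ 0 := by
    rw [← M.filterMeasure_univ]
    exact Measure.measure_univ_ne_zero.2 (M.filterMeasure_ne_zero le_rfl)
  have htop : M.evidence ≠ ∞ := by
    rw [← M.filterMeasure_univ]
    exact measure_ne_top _ _
  have hprob : IsProbabilityMeasure M.posterior := by
    constructor
    rw [M.posterior_eq, Measure.smul_apply, M.filterMeasure_univ, smul_eq_mul,
      ENNReal.inv_mul_cancel h0 htop]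
  refine ⟨hprob, ?_⟩
  have hmeas : ∀ E, MeasurableSet E →
      ∀ᵐ ω ∂P, Tendsto (fun N : ℕ => M.particleMeasure M.T (X N ω) E) atTop
        (𝓝 (M.posterior E)) := by
    intro E hE
    have hlim := (M.completelyTendsto_particleMeasure le_rfl (hW M.T le_rfl)
      (M.completelyTendsto_empiricalMean hW le_rfl)
      (measurable_const.indicator hE) ⟨1, fun z => by
        by_cases hz : z ∈ E <;> simp [hz]⟩ :
      CompletelyTendsto _ (fun _ x => ∫ z, E.indicator (fun _ => (1 : ℝ)) z
        ∂M.particleMeasure M.T x) _).ae_tendsto hX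
    have e : M.posterior E =
        ENNReal.ofReal (⨍ z, E.indicator (fun _ => (1 : ℝ)) z ∂M.filterMeasure M.T) := by
      rw [average_eq', M.filterMeasure_univ, ← M.posterior_eq, integral_indicator_const _ hE,
        smul_eq_mul, mul_one, ofReal_measureReal]
    filter_upwards [hlim] with ω hω
    simp_rw [e, M.particleMeasure_eq_ofReal_integral M.T _ hE]
    exact ENNReal.tendsto_ofReal hω
  intro E hE
  -- A posterior-null set may still carry particle mass, so `E` is squeezed between measurable sets
  -- of equal posterior mass: inclusions are used for the particles, almost everywhere equality only
  -- for the limit.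
  obtain ⟨A, hAE, hA, hAe⟩ := hE.exists_measurable_subset_ae_eq
  obtain ⟨B, hEB, hB, hBe⟩ := hE.exists_measurable_superset_ae_eq
  filter_upwards [hmeas A hA, hmeas B hB] with ω hωA hωB
  rw [measure_congr hAe] at hωA
  rw [measure_congr hBe] at hωB
  exact tendsto_of_tendsto_of_tendsto_of_le_of_le hωA hωB (fun N => measure_mono hAE)
    fun N => measure_mono hEB
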